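/- Write permutations $\sigma\in S_n$ as products of disjoint cycles $(c_0,\dots,c_{p-1})$ with $c_0$ the smallest element of the cycle (fixed points are cycles with $p=1$). For $\tau\in S_j$, $\sigma$ has a cycle $\tau$-match if it has a cycle of length $p\ge j$ and an index $r$ such that the word $c_r c_{r+1}\cdots c_{r+j-1}$ (indices modulo $p$) is in the same relative order as $\tau$. Let $\mathcal{NCMS}_n(\tau)$ be the set of $\sigma\in S_n$ without cycle $\tau$-matches, let $\mathrm{cyc}(\sigma)$ be the number of cycles of $\sigma$, and let $\mathrm{cdes}(\sigma)$ be the sum over the cycles of $\sigma$ of $1+|\{i: 0\le i<p-1,\ c_i>c_{i+1}\}|$. Put $$NCM_\tau(t,x,y)=\sum_{n\ge0}\frac{t^n}{n!}\sum_{\sigma\in\mathcal{NCMS}_n(\tau)}x^{\mathrm{cyc}(\sigma)}y^{\mathrm{cdes}(\sigma)} .$$ Let $R_{n,i,m}$ be the number of words with $i$ zeros and $n-i$ ones in which $m$ zeros never appear consecutively, and put $$F_j(t,y)=1+\sum_{n\ge1}\frac{(-t)^n}{n!}\sum_{i=0}^{n-1}(-1)^i R_{n-1,i,j-1}\,y^{n-i}.$$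 Theorem. Let $j\ge2$ and $\tau=12\cdots j$. Then, as formal power series in $t$ with coefficients in any commutative $\mathbb{Q}$-algebra $A$, for all $x,y\in A$ (in particular for indeterminates $x,y$), $$NCM_\tau(t,x,y)=e^{x\ln\left(1/F_j(t,y)\right)}=\left(\frac1{F_j(t,y)}\right)^{x}=F_j(t,y)^{-x},$$ where $f^a=e^{a\ln f}$ for a power series $f$ in $t$ with constant term $1$ and $a\in A$. -/

import Mathlib

namespace CyclePattern

/-- The reduction of a word `w` of distinct numbers: the letter `w i` is replaced by its rank
(`1` for the smallest letter, `2` for the next one, and so on). -/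
def red {m : ℕ} (w : Fin m → ℕ) (i : Fin m) : ℕ :=
  (Finset.univ.filter fun k => w k ≤ w i).card

/-- The length of the cycle of `σ` that contains `c` (equal to `1` if `c` is a fixed point). -/
def cycleLength {n : ℕ} (σ : Equiv.Perm (Fin n)) (c : Fin n) : ℕ :=
  (Finset.univ.filter fun b => σ.SameCycle c b).card

/-- `σ` has a cycle `τ`-match: on some cycle of length at least `j`, reading `j` consecutive
elements `c, σ c, …, σ ^ (j - 1) c` (cyclically) gives a word with reduction `τ`.
Letters are `0, …, n - 1` here, and `τ i + 1` is the `i`-th letter of `τ` in one-line notation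
on `1, …, j`. -/
def HasCycleMatch {j n : ℕ} (τ : Equiv.Perm (Fin j)) (σ : Equiv.Perm (Fin n)) : Prop :=
  ∃ c : Fin n, j ≤ cycleLength σ c ∧
    ∀ i : Fin j, red (fun k : Fin j => (((σ ^ (k : ℕ)) c : Fin n) : ℕ)) i = (τ i : ℕ) + 1

instance {j n : ℕ} (τ : Equiv.Perm (Fin j)) (σ : Equiv.Perm (Fin n)) :
    Decidable (HasCycleMatch τ σ) := by
  unfold HasCycleMatch; infer_instance

/-- The number of cycles of `σ`, fixed points included: the number of distinct orbits. -/
def cyc {n : ℕ} (σ : Equiv.Perm (Fin n)) : ℕ :=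
  (Finset.univ.image fun a : Fin n => Finset.univ.filter fun b => σ.SameCycle a b).card

/-- The number of descents of the word `w 0, …, w (p - 1)`. -/
def des (p : ℕ) (w : ℕ → ℕ) : ℕ :=
  ((Finset.range (p - 1)).filter fun i => w (i + 1) < w i).card

/-- The smallest elements of the cycles of `σ` (each cycle has exactly one). -/
def cycleMinima {n : ℕ} (σ : Equiv.Perm (Fin n)) : Finset (Fin n) :=
  Finset.univ.filter fun a => ∀ b, σ.SameCycle a b → a ≤ b

/-- The number of cycle descents: the sum over all cycles `(c₀, c₁, …, c_{p-1})`, written with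
the smallest element `c₀` first, of `1 + des (c₀ c₁ … c_{p-1})`. A fixed point contributes `1`. -/
def cdes {n : ℕ} (σ : Equiv.Perm (Fin n)) : ℕ :=
  ∑ c ∈ cycleMinima σ, (1 + des (cycleLength σ c) fun i => (((σ ^ i) c : Fin n) : ℕ))

/-- The permutations of `{0, …, n - 1}` that have no cycle `τ`-match. -/
def noCycleMatch {j : ℕ} (τ : Equiv.Perm (Fin j)) (n : ℕ) : Finset (Equiv.Perm (Fin n)) :=
  Finset.univ.filter fun σ => ¬ HasCycleMatch τ σ

/-- The number of words with `i` zeros and `n - i` ones in which `m` zeros never appear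
consecutively. -/
def zeroOneWords (n i m : ℕ) : ℕ :=
  (Finset.univ.filter fun w : Fin n → Fin 2 =>
    (Finset.univ.filter fun k => w k = 0).card = i ∧
      ¬ List.replicate m (0 : Fin 2) <:+: List.ofFn w).card

/-- The reciprocal of a power series with constant coefficient `1`. -/
noncomputable def recip {B : Type*} [CommRing B] (f : PowerSeries B) : PowerSeries B :=
  PowerSeries.invOfUnit f 1

theorem mul_recip {B : Type*} [CommRing B] (f : PowerSeries B) (hf : PowerSeries.constantCoeff f = 1) :
    f * recip f = 1 :=
  PowerSeries.mul_invOfUnit f 1 (by simpa using hf)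

section Series

variable {A : Type*} [CommRing A] [Algebra ℚ A]

/-- The series `∑ₙ tⁿ/n! ∑_σ x^cyc(σ) y^cdes(σ)`, with `σ` ranging over the permutations of an
`n`-element set without cycle `τ`-matches, as a formal power series in `t`. -/
noncomputable def NCM {j : ℕ} (τ : Equiv.Perm (Fin j)) (x y : A) : PowerSeries A :=
  PowerSeries.mk fun n =>
    algebraMap ℚ A (1 / (n.factorial : ℚ)) *
      ∑ σ ∈ noCycleMatch τ n, x ^ cyc σ * y ^ cdes σ

/-- The series `1 + ∑_{n ≥ 1} (-t)ⁿ/n! ∑_i (-1)^i R_{n-1,i,j-1} y^(n-i)`, where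
`R_{n,i,m} = zeroOneWords n i m`, as a formal power series in `t`. -/
noncomputable def wordSeries (j : ℕ) (y : A) : PowerSeries A :=
  PowerSeries.mk fun n =>
    if n = 0 then 1
    else algebraMap ℚ A ((-1) ^ n / (n.factorial : ℚ)) *
      ∑ i ∈ Finset.range n, (-1) ^ i * (zeroOneWords (n - 1) i (j - 1) : A) * y ^ (n - i)

theorem constantCoeff_wordSeries (j : ℕ) (y : A) :
    PowerSeries.constantCoeff (wordSeries j y) = 1 := by
  rw [← PowerSeries.coeff_zero_eq_constantCoeff_apply]
  simp [wordSeries]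

/-- `exp(h) = ∑ₖ hᵏ/k!` for a power series `h` with constant coefficient `0`. -/
noncomputable def expOf (h : PowerSeries A) : PowerSeries A :=
  (PowerSeries.exp A).subst h

/-- The power `f ^ x = exp(x log f)` of a power series `f` with constant coefficient `1`, for an
exponent `x` in the coefficient ring. -/
noncomputable def cpow (f : PowerSeries A) (x : A) : PowerSeries A :=
  expOf (PowerSeries.C x * PowerSeries.logOf f)

end Series

end CyclePattern

/-! Put m = j - 1 and F = `wordSeries j y`. In a cycle written from its smallest element, an
increasing stretch cannot include the closing step back to that element. Hence a cyclic match is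
exactly a run of m consecutive ascents inside the linear word (`hasCycleMatch_one_iff`), and the
weight of a permutation is a product over its cycles (`permWeight_univ`).

For a single cycle, let C be the exponential generating function in which the smallest element is
not counted. At each adjacent pair write [no ascent] = 1 - [ascent]. Expanding cuts the word into
increasing blocks with no condition between blocks. Inside a block, a 0-1 word records at each gap
whether the ascent is kept (0) or comes from the correction term (1, with factor -y); m kept ascents
in a row are forbidden. The signed block weights are the coefficients of F, and peeling off one
block gives F C = -F' (`sum_blockCoeff_mul_cycleSum`), that is C = -(ln F)'.

For permutations, removing the cycle of the smallest element (`sum_permWeight_insert`) gives G' = x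
C G for the full generating function G. Since F^(-x) solves the same equation with constant term 1,
G = F^(-x). The recursions are run on finite sets, where a sum over subsets plays the role of the
product of exponential generating functions. -/

namespace CyclePattern

/-! ### Logarithm and exponential of power series -/

section Series

variable {A : Type*} [CommRing A] [Algebra ℚ A]

-- `log` is the series of ln(1 + X), so the claim is (1 + X) · `log`' = 1 after substituting f - 1
-- for X and applying the chain rule.
open PowerSeries in
theorem derivative_logOf_mul {f : PowerSeries A} (hf : constantCoeff f = 1) :
    d⁄dX A (logOf f) * f = d⁄dX A f := by
  have hs : HasSubst (f - 1) := HasSubst.of_constantCoeff_zero' (by simp [hf])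
  have h1 : d⁄dX A (log A) * (1 + X) = 1 := by
    rw [deriv_log]
    ext n
    rcases n with _ | n
    · simp [mul_add]
    · simp [mul_add, coeff_succ_mul_X, coeff_one, pow_succ]
  have h2 := congrArg (fun g => g.subst (f - 1)) h1
  simp only [← coe_substAlgHom hs, map_mul, map_add, map_one] at h2
  rw [coe_substAlgHom hs, subst_X hs, add_sub_cancel] at h2
  rw [logOf_eq, derivative_subst hs, map_sub, Derivation.map_one_eq_zero, sub_zero, mul_right_comm, h2, one_mul]

open PowerSeries in
theorem derivative_expOf {h : PowerSeries A} (hh : constantCoeff h = 0) :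
    d⁄dX A (expOf h) = expOf h * d⁄dX A h := by
  rw [expOf, derivative_subst (HasSubst.of_constantCoeff_zero' hh), derivative_exp]

open PowerSeries in
theorem constantCoeff_expOf {h : PowerSeries A} (hh : constantCoeff h = 0) :
    constantCoeff (expOf h) = 1 := by
  have hs : HasSubst h := HasSubst.of_constantCoeff_zero' hh
  have h1 : constantCoeff ((exp A - 1).subst h) = 0 :=
    constantCoeff_subst_eq_zero hh _ (by simp)
  rw [← coe_substAlgHom hs, map_sub, map_one, coe_substAlgHom hs, map_sub, map_one,
    sub_eq_zero] at h1
  exact h1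

-- Both sides have constant term 0, so it suffices to compare derivatives; these are related by
-- differentiating f · (1/f) = 1.
open PowerSeries in
theorem logOf_recip {f : PowerSeries A} (hf : constantCoeff f = 1) :
    logOf (recip f) = - logOf f := by
  have hr : f * recip f = 1 := mul_recip f hf
  have hc : constantCoeff (recip f) = 1 := by
    have := congrArg constantCoeff hr
    simpa [hf] using this
  have : IsAddTorsionFree A := IsAddTorsionFree.of_module_rat A
  apply derivative.ext
  · have h1 := derivative_logOf_mul hf
    have h2 := derivative_logOf_mul hc
    have h3 := congrArg (d⁄dX A) hr
    rw [Derivation.leibniz, Derivation.map_one_eq_zero, smul_eq_mul, smul_eq_mul] at h3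
    rw [map_neg]
    linear_combination f * h2 + (- d⁄dX A (logOf (recip f)) - d⁄dX A (logOf f)) * hr + recip f * h1 + h3
  · simp [constantCoeff_logOf hf, constantCoeff_logOf hc]

end Series

/-! ### Inclusion-exclusion on a single word -/

section Words

variable {A : Type*} [CommRing A] {α : Type*} [LinearOrder α]

/-- The weight `y ^ (number of maximal runs)` of a word `q`, read from its last letter to its
first one, or `0` if `m` consecutive ascents occur; the last letter of the word is thought of as
being followed by `s` further ascents. -/
def runWeight (m : ℕ) (y : A) : ℕ → List α → A
  | _, [] => 0
  | s, [_] => if s < m then y else 0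
  | s, a :: b :: q =>
    if b < a then runWeight m y (s + 1) (b :: q)
    else if s < m then y * runWeight m y 0 (b :: q) else 0

/-- The sum of `(-y) ^ (number of ones)` over the `0`-`1` words `w` of length `n` such that
`0 ^ s w` does not contain `0 ^ m`. -/
def gapWeight (m : ℕ) (y : A) : ℕ → ℕ → A
  | 0, s => if s < m then 1 else 0
  | n + 1, s => if s < m then -y * gapWeight m y n 0 + gapWeight m y n (s + 1) else 0

theorem gapWeight_eq_zero {m : ℕ} {y : A} {n s : ℕ} (h : m ≤ s) : gapWeight m y n s = 0 := by
  cases n <;> simp [gapWeight, h]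

theorem runWeight_eq_zero {m : ℕ} {y : A} {s : ℕ} {q : List α} (h : m ≤ s) :
    runWeight m y s q = 0 := by
  induction q generalizing s with
  | nil => simp [runWeight]
  | cons a q ih =>
    cases q with
    | nil => simp [runWeight, h]
    | cons b q => simp [runWeight, h, ih (h.trans s.le_succ)]

-- This is the inclusion-exclusion expansion, sorted by the first block. Words are read backwards,
-- so blocks of ascents become decreasing prefixes and can be peeled off from the head of the list.
open Classical in
theorem runWeight_cons (m : ℕ) (y : A) (a : α) (l : List α) (s : ℕ) :
    runWeight m y s (a :: l) =
      (if List.IsChain (· > ·) (a :: l) then y * gapWeight m y l.length s else 0) +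
      ∑ k ∈ Finset.range l.length,
        if List.IsChain (· > ·) ((a :: l).take (k + 1)) then
          y * gapWeight m y k s * runWeight m y 0 ((a :: l).drop (k + 1)) else 0 := by
  induction l generalizing a s with
  | nil => simp [runWeight, gapWeight]
  | cons b l ih =>
    by_cases hs : s < m
    swap
    · rw [runWeight_eq_zero (not_lt.1 hs)]
      simp [gapWeight_eq_zero (not_lt.1 hs)]
    rw [List.length_cons, Finset.sum_range_succ']
    by_cases hab : b < a
    · have h1 : ∀ l : List α, List.IsChain (· > ·) (a :: b :: l) ↔ List.IsChain (· > ·) (b :: l) :=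
        fun l => by simp [hab]
      simp only [List.take_succ_cons, List.drop_succ_cons, h1, List.take_zero, List.drop_zero]
      have h2 := ih b 0
      have h3 := ih b (s + 1)
      simp only [List.take_succ_cons, List.drop_succ_cons] at h2 h3
      -- Split by the first gap of the block. The `-y` parts add up to `-y` times the expansion of
      -- `runWeight m y 0 (b :: l)` and cancel the block `[a]`; what remains is the expansion with
      -- `s + 1`.
      have h4 : ∀ k, gapWeight m y (k + 1) s = -y * gapWeight m y k 0 + gapWeight m y k (s + 1) :=
        fun k => by simp [gapWeight, hs]
      have h5 : ∀ k, (if List.IsChain (· > ·) (b :: l.take k) then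
          y * gapWeight m y (k + 1) s * runWeight m y 0 (l.drop k) else 0) =
          -y * (if List.IsChain (· > ·) (b :: l.take k) then
          y * gapWeight m y k 0 * runWeight m y 0 (l.drop k) else 0) +
          (if List.IsChain (· > ·) (b :: l.take k) then
          y * gapWeight m y k (s + 1) * runWeight m y 0 (l.drop k) else 0) := fun k => by
        rw [h4]; split_ifs <;> ring
      simp only [h5, Finset.sum_add_distrib, ← Finset.mul_sum]
      rw [runWeight, if_pos hab, h3]
      have h6 : gapWeight m y 0 s = 1 := by simp [gapWeight, hs]
      rw [h6, h4, if_pos (List.isChain_singleton a), h2]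
      split_ifs <;> ring
    · have h1 : ∀ l : List α, ¬ List.IsChain (· > ·) (a :: b :: l) :=
        fun l => by simp [hab]
      simp [h1, runWeight, hab, hs, gapWeight]

/-- The coefficients of `tⁿ / n!` in the series of alternating word counts. -/
def blockCoeff (m : ℕ) (y : A) : ℕ → A
  | 0 => 1
  | n + 1 => -y * gapWeight m y n 0

-- The term k = 0 is `runWeight` of the whole word. Expanding it by `runWeight_cons` cancels every
-- other term, because `blockCoeff` carries the opposite sign. Only the expansion term in which the
-- entire word, including `c`, is one block survives; as `c` is smallest, this requires just that
-- `l` be decreasing.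
open Classical in
theorem sum_blockCoeff_mul_runWeight (m : ℕ) (y : A) (c : α) (l : List α) (hc : ∀ a ∈ l, c < a) :
    ∑ k ∈ Finset.range (l.length + 1),
        (if List.IsChain (· > ·) (l.take k) then
          blockCoeff m y k * runWeight m y 0 (l.drop k ++ [c]) else 0) =
      if List.IsChain (· > ·) l then - blockCoeff m y (l.length + 1) else 0 := by
  rw [Finset.sum_range_succ']
  simp only [List.take_zero, List.drop_zero, List.IsChain.nil, if_true, blockCoeff, one_mul]
  cases l with
  | nil => by_cases h : 0 < m <;> simp [runWeight, gapWeight, h]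
  | cons a l =>
    have h1 : List.IsChain (· > ·) (a :: l ++ [c]) ↔ List.IsChain (· > ·) (a :: l) := by
      rw [List.isChain_append]
      refine ⟨fun h => h.1, fun h => ⟨h, by simp, fun x hx z hz => ?_⟩⟩
      simp only [List.head?_cons, Option.mem_def, Option.some.injEq] at hz
      subst hz
      exact hc _ (List.mem_of_mem_getLast? hx)
    have h2 := runWeight_cons m y a (l ++ [c]) 0
    rw [← List.cons_append] at h2
    rw [h2, List.length_append, List.length_singleton, if_congr h1 rfl rfl, List.length_cons]
    have h3 : ∀ k ∈ Finset.range (l.length + 1),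
        (if List.IsChain (· > ·) ((a :: l ++ [c]).take (k + 1)) then
          y * gapWeight m y k 0 * runWeight m y 0 ((a :: l ++ [c]).drop (k + 1)) else 0) =
        - (if List.IsChain (· > ·) ((a :: l).take (k + 1)) then
          -y * gapWeight m y k 0 * runWeight m y 0 ((a :: l).drop (k + 1) ++ [c]) else 0) := by
      intro k hk
      have hk' : k + 1 ≤ (a :: l).length := by simpa using Finset.mem_range.1 hk
      rw [List.take_append_of_le_length hk', List.drop_append_of_le_length hk']
      split_ifs <;> ring
    rw [Finset.sum_congr rfl h3, Finset.sum_neg_distrib]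
    split_ifs <;> ring

end Words

/-! ### From words to sums over subsets -/

section Orderings

variable {A : Type*} [CommRing A] {α : Type*} [LinearOrder α]

/-- The words in which each element of `D` occurs exactly once. -/
def orderings (D : Finset α) : Finset (List α) := D.val.lists.toFinset

theorem mem_orderings {D : Finset α} {l : List α} :
    l ∈ orderings D ↔ l.Nodup ∧ l.toFinset = D := by
  rw [orderings, Multiset.mem_toFinset, Multiset.mem_lists_iff]
  constructor
  · intro h
    have h1 : l.Nodup := by
      have := D.nodup
      rw [h] at this
      exact this
    refine ⟨h1, ?_⟩
    ext a
    rw [List.mem_toFinset, ← Finset.mem_val, h]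
    exact Iff.rfl
  · rintro ⟨h1, rfl⟩
    rw [List.toFinset_val, h1.dedup]
    rfl

theorem length_of_mem_orderings {D : Finset α} {l : List α} (h : l ∈ orderings D) :
    l.length = D.card := by
  obtain ⟨h1, rfl⟩ := mem_orderings.1 h
  exact (List.toFinset_card_of_nodup h1).symm

theorem isChain_iff_sort {l : List α} (h : l.Nodup) :
    List.IsChain (· > ·) l ↔ l.toFinset.sort (· ≥ ·) = l := by
  rw [List.isChain_iff_pairwise]
  constructor
  · intro h1
    exact (List.toFinset_sort _ h).2 (h1.imp le_of_lt)
  · intro h1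
    rw [← h1]
    exact (Finset.sortedGT_sort _).pairwise

open Classical in
theorem sum_orderings_isChain (D : Finset α) (b : A) :
    ∑ l ∈ orderings D, (if List.IsChain (· > ·) l then b else 0) = b := by
  rw [Finset.sum_eq_single (D.sort (· ≥ ·))]
  · rw [if_pos]
    rw [isChain_iff_sort (Finset.sort_nodup _ _), Finset.sort_toFinset]
  · intro l hl hne
    rw [if_neg]
    intro hc
    obtain ⟨h1, rfl⟩ := mem_orderings.1 hl
    exact hne ((isChain_iff_sort h1).1 hc).symm
  · intro h
    exact absurd (mem_orderings.2 ⟨Finset.sort_nodup _ _, Finset.sort_toFinset _ _⟩) h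

-- A decreasing prefix is determined by its set of letters, so a word with a marked decreasing
-- prefix amounts to a subset E and an ordering of the complement.
open Classical in
theorem sum_orderings_take_drop (D : Finset α) (f : ℕ → A) (g : List α → A) :
    ∑ l ∈ orderings D, ∑ k ∈ Finset.range (l.length + 1),
        (if List.IsChain (· > ·) (l.take k) then f k * g (l.drop k) else 0) =
      ∑ E ∈ D.powerset, f E.card * ∑ e ∈ orderings (D \ E), g e := by
  simp only [Finset.mul_sum, ← Finset.sum_filter]
  rw [Finset.sum_sigma', Finset.sum_sigma']
  refine Finset.sum_bij' (fun p _ => ⟨(p.1.take p.2).toFinset, p.1.drop p.2⟩)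
    (fun p _ => ⟨p.1.sort (· ≥ ·) ++ p.2, p.1.card⟩) ?_ ?_ ?_ ?_ ?_
  · rintro ⟨l, k⟩ h
    simp only [Finset.mem_sigma, Finset.mem_filter, Finset.mem_powerset, mem_orderings] at h ⊢
    obtain ⟨⟨h1, rfl⟩, h2, h3⟩ := h
    have h4 := h1
    rw [← List.take_append_drop k l] at h4
    refine ⟨fun a ha => ?_, h1.sublist (List.drop_sublist _ _), ?_⟩
    · exact List.mem_toFinset.2 (List.mem_of_mem_take (List.mem_toFinset.1 ha))
    · conv_rhs => rw [← List.take_append_drop k l, List.take_append_drop k l]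
      have h5 : l.toFinset = (l.take k).toFinset ∪ (l.drop k).toFinset := by
        rw [← List.toFinset_append, List.take_append_drop]
      rw [h5, Finset.union_sdiff_cancel_left]
      exact List.disjoint_toFinset_iff_disjoint.2 (List.disjoint_of_nodup_append h4)
  · rintro ⟨E, e⟩ h
    simp only [Finset.mem_sigma, Finset.mem_filter, Finset.mem_powerset, mem_orderings,
      Finset.mem_range] at h ⊢
    obtain ⟨h1, h2, h3⟩ := h
    refine ⟨⟨?_, ?_⟩, ?_, ?_⟩
    · refine List.Nodup.append (Finset.sort_nodup _ _) h2 ?_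
      rw [← List.disjoint_toFinset_iff_disjoint, h3, Finset.sort_toFinset]
      exact Finset.disjoint_sdiff
    · rw [List.toFinset_append, Finset.sort_toFinset, h3, Finset.union_sdiff_of_subset h1]
    · rw [List.length_append, Finset.length_sort]; omega
    · rw [List.take_left' (Finset.length_sort _), isChain_iff_sort (Finset.sort_nodup _ _),
        Finset.sort_toFinset]
  · rintro ⟨l, k⟩ h
    simp only [Finset.mem_sigma, Finset.mem_filter, mem_orderings, Finset.mem_range] at h
    obtain ⟨⟨h1, rfl⟩, h2, h3⟩ := h
    have h4 : (l.take k).Nodup := h1.sublist (List.take_sublist _ _)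
    have h5 := (isChain_iff_sort h4).1 h3
    simp only [h5, List.take_append_drop, List.toFinset_card_of_nodup h4, List.length_take]
    rw [min_eq_left (by omega)]
  · rintro ⟨E, e⟩ h
    simp only [List.take_left' (Finset.length_sort _), List.drop_left' (Finset.length_sort _),
      Finset.sort_toFinset]
  · rintro ⟨l, k⟩ h
    simp only [Finset.mem_sigma, Finset.mem_filter, mem_orderings, Finset.mem_range] at h
    obtain ⟨⟨h1, rfl⟩, h2, h3⟩ := h
    have h4 : (l.take k).Nodup := h1.sublist (List.take_sublist _ _)
    simp only [List.toFinset_card_of_nodup h4, List.length_take]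
    rw [min_eq_left (by omega)]

/-- The total weight of the cycles on `insert c D` with smallest element `c`. -/
def cycleSum (m : ℕ) (y : A) (c : α) (D : Finset α) : A :=
  ∑ l ∈ orderings D, runWeight m y 0 (l ++ [c])

theorem sum_blockCoeff_mul_cycleSum (m : ℕ) (y : A) (c : α) (D : Finset α) (hc : ∀ a ∈ D, c < a) :
    ∑ E ∈ D.powerset, blockCoeff m y E.card * cycleSum m y c (D \ E) =
      - blockCoeff m y (D.card + 1) := by
  classical
  have h := sum_orderings_take_drop D (blockCoeff m y) fun e => runWeight m y 0 (e ++ [c])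
  simp only [cycleSum]
  rw [← h, ← sum_orderings_isChain D (- blockCoeff m y (D.card + 1))]
  refine Finset.sum_congr rfl fun l hl => ?_
  rw [sum_blockCoeff_mul_runWeight, length_of_mem_orderings hl]
  intro a ha
  exact hc a (by rw [← (mem_orderings.1 hl).2]; exact List.mem_toFinset.2 ha)

end Orderings

/-! ### Block weights as counts of 0-1 words -/

section ZeroOneWords

/-- A block of zeros cannot contain the letter 1, so it lies entirely on one side of it. -/
theorem replicate_zero_infix_iff (m s : ℕ) (l : List (Fin 2)) :
    List.replicate m (0 : Fin 2) <:+: List.replicate s 0 ++ 1 :: l ↔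
      m ≤ s ∨ List.replicate m (0 : Fin 2) <:+: l := by
  have hp : ∀ m s : ℕ, List.replicate m (0 : Fin 2) <+: List.replicate s 0 ++ 1 :: l ↔ m ≤ s := by
    intro m
    induction m with
    | zero => simp
    | succ m ih =>
      intro s
      cases s with
      | zero => simp [List.replicate_succ]
      | succ s => simp [List.replicate_succ, ih]
  induction s with
  | zero =>
    have := hp m 0
    simp only [List.replicate_zero, List.nil_append] at this ⊢
    rw [List.infix_cons_iff, this]
  | succ s ih =>
    have := hp m (s + 1)
    simp only [List.replicate_succ, List.cons_append] at this ⊢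
    have h1 := List.infix_cons_iff.trans (or_congr this ih)
    rw [h1, ← or_assoc]
    congr! 1
    omega

theorem gapWeight_eq_sum {A : Type*} [CommRing A] (m : ℕ) (y : A) (n s : ℕ) :
    gapWeight m y n s = ∑ w : Fin n → Fin 2,
      if List.replicate m (0 : Fin 2) <:+: List.replicate s 0 ++ List.ofFn w then 0
      else (-y) ^ (Finset.univ.filter fun k => w k = 1).card := by
  induction n generalizing s with
  | zero =>
    have h1 : List.replicate m (0 : Fin 2) <:+: List.replicate s 0 ↔ m ≤ s :=
      ⟨fun h => by simpa using h.length_le, fun h =>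
        ⟨[], List.replicate (s - m) 0, by simp [List.replicate_append_replicate, h]⟩⟩
    by_cases h : s < m <;> simp [gapWeight, h1, h]
  | succ n ih =>
    have hsum : ∀ f : (Fin (n + 1) → Fin 2) → A,
        ∑ w, f w = ∑ w, f (Fin.cons 0 w) + ∑ w, f (Fin.cons 1 w) := fun f => by
      rw [← (Fin.consEquiv fun _ : Fin (n + 1) => Fin 2).sum_comp, Fintype.sum_prod_type,
        Fin.sum_univ_two]
      rfl
    rw [hsum]
    have h0 : ∀ w : Fin n → Fin 2, List.replicate s (0 : Fin 2) ++ 0 :: List.ofFn w =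
        List.replicate (s + 1) 0 ++ List.ofFn w := fun w => by
      rw [List.replicate_succ', List.append_assoc, List.singleton_append]
    simp only [List.ofFn_cons, replicate_zero_infix_iff, h0,
      Fin.card_filter_univ_succ, Fin.cons_zero, Fin.cons_succ]
    simp only [zero_ne_one, if_false, if_true, ← ih (s + 1)]
    by_cases hs : s < m
    · have h1 := ih 0
      simp only [List.replicate_zero, List.nil_append] at h1
      rw [gapWeight, if_pos hs, h1, Finset.mul_sum, add_comm]
      congr 1
      refine Finset.sum_congr rfl fun w _ => ?_
      simp only [not_le.2 hs, false_or, pow_succ]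
      split_ifs <;> ring
    · rw [gapWeight, if_neg hs, gapWeight_eq_zero (by omega)]
      simp [not_lt.1 hs]

theorem sum_zeroOneWords {A : Type*} [CommRing A] (m : ℕ) (y : A) (n : ℕ) :
    ∑ i ∈ Finset.range (n + 1), (zeroOneWords n i m : A) * (-y) ^ (n - i) =
      gapWeight m y n 0 := by
  rw [gapWeight_eq_sum]
  simp only [List.replicate_zero, List.nil_append]
  rw [← Finset.sum_fiberwise_of_maps_to (t := Finset.range (n + 1))
    (g := fun w : Fin n → Fin 2 => (Finset.univ.filter fun k => w k = 0).card)]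
  · refine Finset.sum_congr rfl fun i hi => ?_
    -- Each fibre is split according to whether the forbidden block occurs; words containing it
    -- contribute 0.
    rw [zeroOneWords, ← nsmul_eq_mul, ← Finset.sum_const, Finset.filter_and,
      ← Finset.sum_filter_add_sum_filter_not (Finset.filter _ _)
        (fun w : Fin n → Fin 2 => ¬ List.replicate m (0 : Fin 2) <:+: List.ofFn w)]
    rw [← Finset.filter_and, Finset.filter_filter, Finset.filter_filter]
    rw [eq_comm]
    refine (add_eq_left.2 ?_).trans ?_
    · refine Finset.sum_eq_zero fun w hw => ?_
      rw [if_pos]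
      simpa using (Finset.mem_filter.1 hw).2.2
    · refine Finset.sum_congr rfl fun w hw => ?_
      obtain ⟨-, h1, h2⟩ := Finset.mem_filter.1 hw
      rw [if_neg h2]
      congr 1
      have h3 := Finset.card_filter_add_card_filter_not (s := Finset.univ) (fun k => w k = 0)
      have h4 : ∀ a : Fin 2, ¬ a = 0 ↔ a = 1 := by decide
      simp only [h4, h1, Finset.card_univ, Fintype.card_fin] at h3
      omega
  · intro w _
    rw [Finset.mem_range, Nat.lt_succ_iff]
    simpa using Finset.card_filter_le (Finset.univ : Finset (Fin n)) fun k => w k = 0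

end ZeroOneWords

/-! ### Exponential coefficients and the generating function of one cycle -/

section Coefficients

variable {A : Type*} [CommRing A]

/-- The coefficient of `tⁿ / n!` in a power series. -/
noncomputable def expCoeff (f : PowerSeries A) (n : ℕ) : A := (n.factorial : A) * PowerSeries.coeff n f

theorem expCoeff_mul (f g : PowerSeries A) (n : ℕ) :
    expCoeff (f * g) n =
      ∑ k ∈ Finset.range (n + 1), n.choose k • (expCoeff f k * expCoeff g (n - k)) := by
  rw [expCoeff, PowerSeries.coeff_mul, Finset.Nat.sum_antidiagonal_eq_sum_range_succ
    fun i k => PowerSeries.coeff i f * PowerSeries.coeff k g, Finset.mul_sum]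
  refine Finset.sum_congr rfl fun k hk => ?_
  rw [← Nat.choose_mul_factorial_mul_factorial (Nat.lt_succ_iff.1 (Finset.mem_range.1 hk)),
    nsmul_eq_mul, expCoeff, expCoeff]
  push_cast
  ring

theorem expCoeff_derivative (f : PowerSeries A) (n : ℕ) :
    expCoeff (PowerSeries.derivative A f) n = expCoeff f (n + 1) := by
  rw [expCoeff, expCoeff, PowerSeries.coeff_derivative, Nat.factorial_succ]
  push_cast
  ring

/-- The binomial coefficient counts the subsets of a given size; in this form the product rule
matches the recursions on finite sets. -/
theorem expCoeff_mul_card {α : Type*} [DecidableEq α] (f g : PowerSeries A) (D : Finset α) :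
    expCoeff (f * g) D.card =
      ∑ E ∈ D.powerset, expCoeff f E.card * expCoeff g (D \ E).card := by
  rw [expCoeff_mul, ← Finset.sum_powerset_apply_card]
  refine Finset.sum_congr rfl fun E hE => ?_
  rw [Finset.card_sdiff_of_subset (Finset.mem_powerset.1 hE)]

theorem expCoeff_neg (f : PowerSeries A) (n : ℕ) : expCoeff (-f) n = - expCoeff f n := by
  simp [expCoeff]

variable [Algebra ℚ A]

theorem algebraMap_inv_factorial_mul (n : ℕ) (a : A) :
    algebraMap ℚ A (1 / (n.factorial : ℚ)) * ((n.factorial : A) * a) = a := by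
  rw [← mul_assoc, ← map_natCast (algebraMap ℚ A), ← map_mul,
    one_div_mul_cancel (by exact_mod_cast n.factorial_ne_zero), map_one, one_mul]

theorem expCoeff_wordSeries (j : ℕ) (y : A) (n : ℕ) :
    expCoeff (wordSeries j y) n = blockCoeff (j - 1) y n := by
  cases n with
  | zero => simp [expCoeff, wordSeries, blockCoeff]
  | succ n =>
    rw [expCoeff, wordSeries, PowerSeries.coeff_mk, if_neg n.succ_ne_zero, ← mul_assoc,
      ← map_natCast (algebraMap ℚ A), ← map_mul,
      mul_div_cancel₀ _ (by exact_mod_cast (n + 1).factorial_ne_zero), blockCoeff,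
      ← sum_zeroOneWords, Finset.mul_sum, Finset.mul_sum]
    refine Finset.sum_congr rfl fun i hi => ?_
    -- Here d is the number of ones; the sign (-1)^(i + d + 1) (-1)^i reduces to (-1)^(d + 1).
    obtain ⟨d, rfl⟩ := Nat.exists_eq_add_of_le (Nat.lt_succ_iff.1 (Finset.mem_range.1 hi))
    have h1 : i + d + 1 - i = d + 1 := by omega
    have h2 : ((-1 : A) ^ i) * (-1) ^ i = 1 := by rw [← mul_pow]; simp
    rw [h1, Nat.add_sub_cancel_left, Nat.add_sub_cancel, neg_pow y d]
    simp only [map_pow, map_neg, map_one]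
    linear_combination (-(-1) ^ d * (zeroOneWords (i + d) i (j - 1) : A) * y ^ (d + 1)) * h2

/-- The series of words without long runs that begin with their smallest letter, that letter
being unmarked. -/
noncomputable def cycleSeries (j : ℕ) (y : A) : PowerSeries A :=
  - PowerSeries.derivative A (PowerSeries.logOf (wordSeries j y))

/-- Both sides satisfy the recursion F C = -F'. Its term E = ∅ has coefficient 1, so the value at
`D` is determined by the values at proper subsets. -/
theorem cycleSum_eq_expCoeff {α : Type*} [LinearOrder α] (j : ℕ) (y : A) (c : α) (D : Finset α)
    (hc : ∀ a ∈ D, c < a) :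
    cycleSum (j - 1) y c D = expCoeff (cycleSeries j y) D.card := by
  induction D using Finset.strongInduction with
  | H D ih =>
    have h1 := sum_blockCoeff_mul_cycleSum (j - 1) y c D hc
    have h2 : wordSeries j y * cycleSeries j y = - PowerSeries.derivative A (wordSeries j y) := by
      rw [← derivative_logOf_mul (constantCoeff_wordSeries j y), cycleSeries]
      ring
    have h3 := expCoeff_mul_card (wordSeries j y) (cycleSeries j y) D
    rw [h2, expCoeff_neg, expCoeff_derivative, expCoeff_wordSeries] at h3
    rw [h3, ← Finset.add_sum_erase _ _ (Finset.empty_mem_powerset D),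
      ← Finset.add_sum_erase _ _ (Finset.empty_mem_powerset D), ← eq_sub_iff_add_eq] at h1
    simp only [Finset.card_empty, blockCoeff, one_mul, Finset.sdiff_empty,
      expCoeff_wordSeries] at h1
    rw [h1, add_sub_assoc, ← Finset.sum_sub_distrib, Finset.sum_eq_zero, add_zero]
    intro E hE
    obtain ⟨hE1, hE2⟩ := Finset.mem_erase.1 hE
    have hE3 : D \ E ⊂ D := Finset.sdiff_ssubset (Finset.mem_powerset.1 hE2)
      (Finset.nonempty_iff_ne_empty.2 hE1)
    rw [ih _ hE3 fun a ha => hc a (hE3.1 ha), sub_self]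

end Coefficients

/-! ### Cycles as words -/

section Orbits

variable {n : ℕ}

/-- The cycle of `σ` through `c` as a word that begins with `c`. -/
def orbitList (σ : Equiv.Perm (Fin n)) (c : Fin n) : List (Fin n) :=
  (List.range (cycleLength σ c)).map fun i => (σ ^ i) c

theorem sameCycle_iff_exists_nat (σ : Equiv.Perm (Fin n)) (c b : Fin n) :
    σ.SameCycle c b ↔ ∃ i : ℕ, (σ ^ i) c = b :=
  ⟨fun h => h.exists_nat_pow_eq, fun ⟨i, hi⟩ => ⟨i, by simpa using hi⟩⟩

theorem cycleLength_eq_minimalPeriod (σ : Equiv.Perm (Fin n)) (c : Fin n) :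
    cycleLength σ c = Function.minimalPeriod σ c := by
  have h1 : Function.Periodic (fun i : ℕ => (σ ^ i) c) (Function.minimalPeriod σ c) := fun i => by
    simp only [Equiv.Perm.coe_pow]
    exact Function.iterate_add_minimalPeriod_eq
  have hpos : 0 < Function.minimalPeriod σ c := by
    refine Function.minimalPeriod_pos_of_mem_periodicPts ?_
    exact Function.Injective.mem_periodicPts σ.injective c
  have h2 : (Finset.univ.filter fun b => σ.SameCycle c b) =
      (Finset.range (Function.minimalPeriod σ c)).image fun i => (σ ^ i) c := by
    ext b
    simp only [Finset.mem_filter, Finset.mem_univ, true_and, Finset.mem_image, Finset.mem_range,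
      sameCycle_iff_exists_nat]
    constructor
    · rintro ⟨i, hi⟩
      exact ⟨i % _, Nat.mod_lt _ hpos, by rw [← hi]; exact h1.map_mod_nat i⟩
    · rintro ⟨i, -, hi⟩
      exact ⟨i, hi⟩
  rw [cycleLength, h2, Finset.card_image_of_injOn, Finset.card_range]
  intro i hi k hk hik
  simp only [Equiv.Perm.coe_pow] at hik
  exact Function.iterate_injOn_Iio_minimalPeriod (by simpa using hi) (by simpa using hk) hik

theorem cycleLength_pos (σ : Equiv.Perm (Fin n)) (c : Fin n) : 0 < cycleLength σ c :=
  Finset.card_pos.2 ⟨c, by simp [Equiv.Perm.SameCycle.refl]⟩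

theorem pow_cycleLength (σ : Equiv.Perm (Fin n)) (c : Fin n) : (σ ^ cycleLength σ c) c = c := by
  rw [cycleLength_eq_minimalPeriod, Equiv.Perm.coe_pow]
  exact Function.iterate_minimalPeriod

theorem pow_injOn_cycleLength (σ : Equiv.Perm (Fin n)) (c : Fin n) {i k : ℕ}
    (hi : i < cycleLength σ c) (hk : k < cycleLength σ c) (h : (σ ^ i) c = (σ ^ k) c) : i = k := by
  rw [cycleLength_eq_minimalPeriod] at hi hk
  simp only [Equiv.Perm.coe_pow] at h
  exact Function.iterate_injOn_Iio_minimalPeriod hi hk h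

theorem exists_pow_eq_of_sameCycle {σ : Equiv.Perm (Fin n)} {c b : Fin n} (h : σ.SameCycle c b) :
    ∃ i < cycleLength σ c, (σ ^ i) c = b := by
  obtain ⟨i, hi⟩ := (sameCycle_iff_exists_nat σ c b).1 h
  have h1 : Function.Periodic (fun i : ℕ => (σ ^ i) c) (cycleLength σ c) := fun i => by
    simp only [cycleLength_eq_minimalPeriod, Equiv.Perm.coe_pow]
    exact Function.iterate_add_minimalPeriod_eq
  exact ⟨i % _, Nat.mod_lt _ (cycleLength_pos σ c), by rw [← hi]; exact h1.map_mod_nat i⟩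

theorem mem_orbitList {σ : Equiv.Perm (Fin n)} {c b : Fin n} :
    b ∈ orbitList σ c ↔ σ.SameCycle c b := by
  simp only [orbitList, List.mem_map, List.mem_range]
  exact ⟨fun ⟨i, _, hi⟩ => (sameCycle_iff_exists_nat σ c b).2 ⟨i, hi⟩, exists_pow_eq_of_sameCycle⟩

theorem nodup_orbitList (σ : Equiv.Perm (Fin n)) (c : Fin n) : (orbitList σ c).Nodup :=
  List.Nodup.map_on (fun _ hi _ hk h => pow_injOn_cycleLength σ c (List.mem_range.1 hi)
    (List.mem_range.1 hk) h) List.nodup_range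

theorem orbitList_eq_cons (σ : Equiv.Perm (Fin n)) (c : Fin n) :
    orbitList σ c = c :: (orbitList σ c).tail := by
  obtain ⟨k, hk⟩ := Nat.exists_eq_add_of_le' (cycleLength_pos σ c)
  simp [orbitList, hk, List.range_succ_eq_map]

theorem formPerm_orbitList (σ : Equiv.Perm (Fin n)) (c : Fin n) {a : Fin n}
    (ha : a ∈ orbitList σ c) : (orbitList σ c).formPerm a = σ a := by
  obtain ⟨i, hi, rfl⟩ := List.getElem_of_mem ha
  rw [List.formPerm_apply_getElem _ (nodup_orbitList σ c)]
  have hl : (orbitList σ c).length = cycleLength σ c := by simp [orbitList]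
  simp only [hl]
  simp only [orbitList, List.getElem_map, List.getElem_range, ← Equiv.Perm.mul_apply, ← pow_succ']
  rw [hl] at hi
  rcases Nat.lt_or_ge (i + 1) (cycleLength σ c) with h | h
  · rw [Nat.mod_eq_of_lt h]
  · have h1 : i + 1 = cycleLength σ c := by omega
    rw [h1, Nat.mod_self, pow_cycleLength, pow_zero, Equiv.Perm.one_apply]

theorem orbitList_eq_of_formPerm {σ : Equiv.Perm (Fin n)} {c : Fin n} {l : List (Fin n)}
    (hl : (c :: l).Nodup) (h : ∀ a ∈ c :: l, σ a = (c :: l).formPerm a) :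
    orbitList σ c = c :: l := by
  have hpow : ∀ i : ℕ, (σ ^ i) c = ((c :: l).formPerm ^ i) c ∧ (σ ^ i) c ∈ c :: l := by
    intro i
    induction i with
    | zero => simp
    | succ i ih =>
      rw [pow_succ', pow_succ', Equiv.Perm.mul_apply, Equiv.Perm.mul_apply, h _ ih.2, ← ih.1]
      exact ⟨rfl, List.formPerm_apply_mem_of_mem ih.2⟩
  have hget : ∀ i (hi : i < (c :: l).length), (σ ^ i) c = (c :: l)[i] := by
    intro i hi
    rw [(hpow i).1, List.formPerm_pow_apply_head c l hl]
    simp only [Nat.mod_eq_of_lt hi]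
  have hset : (Finset.univ.filter fun b => σ.SameCycle c b) = (c :: l).toFinset := by
    ext b
    rw [Finset.mem_filter, sameCycle_iff_exists_nat, List.mem_toFinset]
    constructor
    · rintro ⟨-, i, rfl⟩
      exact (hpow i).2
    · intro hb
      obtain ⟨i, hi, rfl⟩ := List.getElem_of_mem hb
      exact ⟨Finset.mem_univ _, i, hget i hi⟩
  have hlen : cycleLength σ c = (c :: l).length := by
    rw [cycleLength, hset, List.toFinset_card_of_nodup hl]
  refine List.ext_getElem (by simp [orbitList, hlen]) fun i h1 h2 => ?_
  simp only [orbitList, List.getElem_map, List.getElem_range]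
  exact hget i h2

/-- The orbit of `c` never leaves the stable set `T`, so it sees only values on which the
permutations agree. This transfers cycles when another cycle is multiplied in. -/
theorem sameCycle_and_orbitList_congr {σ ρ : Equiv.Perm (Fin n)} {T : Finset (Fin n)}
    (h : ∀ a ∈ T, σ a = ρ a) (hT : ∀ a ∈ T, ρ a ∈ T) {c : Fin n} (hc : c ∈ T) :
    (∀ b, σ.SameCycle c b ↔ ρ.SameCycle c b) ∧ orbitList σ c = orbitList ρ c := by
  have hpow : ∀ i : ℕ, (σ ^ i) c = (ρ ^ i) c ∧ (ρ ^ i) c ∈ T := by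
    intro i
    induction i with
    | zero => simpa
    | succ i ih =>
      rw [pow_succ', pow_succ', Equiv.Perm.mul_apply, Equiv.Perm.mul_apply, ih.1, h _ ih.2]
      exact ⟨rfl, hT _ ih.2⟩
  have h1 : ∀ b, σ.SameCycle c b ↔ ρ.SameCycle c b := fun b => by
    simp only [sameCycle_iff_exists_nat, (hpow _).1]
  refine ⟨h1, ?_⟩
  simp only [orbitList, cycleLength, h1, (hpow _).1]

end Orbits

/-! ### Splitting off the cycle of the smallest element -/

section PermWeight

variable {A : Type*} [CommRing A] {n : ℕ}

/-- The permutations that fix all elements outside of `S`. -/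
def permsOn (S : Finset (Fin n)) : Finset (Equiv.Perm (Fin n)) :=
  Finset.univ.filter fun σ => ∀ a, a ∉ S → σ a = a

/-- The product of the weights of the cycles of `σ` on `S`. -/
def permWeight (m : ℕ) (x y : A) (S : Finset (Fin n)) (σ : Equiv.Perm (Fin n)) : A :=
  ∏ c ∈ S.filter (fun c => ∀ b, σ.SameCycle c b → c ≤ b),
    x * runWeight m y 0 (orbitList σ c).reverse

theorem mem_permsOn {S : Finset (Fin n)} {σ : Equiv.Perm (Fin n)} :
    σ ∈ permsOn S ↔ ∀ a, a ∉ S → σ a = a := by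
  simp [permsOn]

theorem apply_mem_of_mem_permsOn {S : Finset (Fin n)} {σ : Equiv.Perm (Fin n)}
    (h : σ ∈ permsOn S) {a : Fin n} (ha : a ∈ S) : σ a ∈ S := by
  by_contra h1
  have h2 := mem_permsOn.1 h _ h1
  rw [σ.injective h2] at h1
  exact h1 ha

theorem mem_of_sameCycle {S : Finset (Fin n)} {σ : Equiv.Perm (Fin n)}
    (h : σ ∈ permsOn S) {a b : Fin n} (ha : a ∈ S) (hab : σ.SameCycle a b) : b ∈ S := by
  obtain ⟨i, rfl⟩ := (sameCycle_iff_exists_nat σ a b).1 hab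
  clear hab
  induction i with
  | zero => simpa
  | succ i ih =>
    rw [pow_succ', Equiv.Perm.mul_apply]
    exact apply_mem_of_mem_permsOn h ih

section Split

variable {c : Fin n} {S : Finset (Fin n)} {l : List (Fin n)}

theorem formPerm_mul_mem_permsOn (hl : (c :: l).Nodup) (hc : c ∉ S) (hlS : l.toFinset ⊆ S)
    {ρ : Equiv.Perm (Fin n)} (hρ : ρ ∈ permsOn (S \ l.toFinset)) :
    (c :: l).formPerm * ρ ∈ permsOn (insert c S) ∧
      orbitList ((c :: l).formPerm * ρ) c = c :: l := by
  have hfix : ∀ a, a ∉ S \ l.toFinset → ρ a = a := mem_permsOn.1 hρ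
  constructor
  · rw [mem_permsOn]
    intro a ha
    rw [Finset.mem_insert, not_or] at ha
    rw [Equiv.Perm.mul_apply, hfix a fun h => ha.2 (Finset.mem_sdiff.1 h).1]
    refine List.formPerm_apply_of_notMem ?_
    rw [List.mem_cons, not_or]
    exact ⟨ha.1, fun h => ha.2 (hlS (List.mem_toFinset.2 h))⟩
  · refine orbitList_eq_of_formPerm hl fun a ha => ?_
    rw [Equiv.Perm.mul_apply, hfix]
    intro h
    rw [Finset.mem_sdiff, List.mem_toFinset] at h
    rcases List.mem_cons.1 ha with rfl | h1
    · exact hc h.1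
    · exact h.2 h1

theorem permWeight_formPerm_mul (m : ℕ) (x y : A) (hl : (c :: l).Nodup) (hc : ∀ a ∈ S, c < a)
    (hlS : l.toFinset ⊆ S) {ρ : Equiv.Perm (Fin n)} (hρ : ρ ∈ permsOn (S \ l.toFinset)) :
    permWeight m x y (insert c S) ((c :: l).formPerm * ρ) =
      x * runWeight m y 0 (l.reverse ++ [c]) * permWeight m x y (S \ l.toFinset) ρ := by
  have hcS : c ∉ S := fun h => lt_irrefl _ (hc c h)
  obtain ⟨hσ, horb⟩ := formPerm_mul_mem_permsOn hl hcS hlS hρ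
  set σ := (c :: l).formPerm * ρ with hσdef
  have hT : ∀ a ∈ S \ l.toFinset, ρ a ∈ S \ l.toFinset :=
    fun a ha => apply_mem_of_mem_permsOn hρ ha
  have hagree : ∀ a ∈ S \ l.toFinset, σ a = ρ a := by
    intro a ha
    rw [hσdef, Equiv.Perm.mul_apply]
    refine List.formPerm_apply_of_notMem ?_
    have h1 := hT a ha
    rw [Finset.mem_sdiff, List.mem_toFinset] at h1
    rw [List.mem_cons, not_or]
    refine ⟨?_, h1.2⟩
    intro h2
    exact hcS (h2 ▸ h1.1)
  have hset : (insert c S).filter (fun c => ∀ b, σ.SameCycle c b → c ≤ b) =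
      insert c ((S \ l.toFinset).filter (fun c => ∀ b, ρ.SameCycle c b → c ≤ b)) := by
    ext a
    rw [Finset.mem_filter, Finset.mem_insert, Finset.mem_insert, Finset.mem_filter]
    constructor
    · rintro ⟨rfl | ha, h1⟩
      · exact Or.inl rfl
      · right
        have h2 : a ∈ S \ l.toFinset := by
          rw [Finset.mem_sdiff, List.mem_toFinset]
          refine ⟨ha, fun h3 => ?_⟩
          have h4 : σ.SameCycle c a := mem_orbitList.1 (by rw [horb]; exact List.mem_cons_of_mem _ h3)
          exact absurd (h1 c h4.symm) (not_le.2 (hc a ha))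
        refine ⟨h2, fun b hb => h1 b ?_⟩
        exact ((sameCycle_and_orbitList_congr hagree hT h2).1 b).2 hb
    · rintro (rfl | ⟨ha, h1⟩)
      · refine ⟨Or.inl rfl, fun b hb => ?_⟩
        rcases Finset.mem_insert.1 (mem_of_sameCycle hσ (Finset.mem_insert_self _ _) hb) with h | h
        · exact h.ge
        · exact (hc b h).le
      · refine ⟨Or.inr (Finset.mem_sdiff.1 ha).1, fun b hb => h1 b ?_⟩
        exact ((sameCycle_and_orbitList_congr hagree hT ha).1 b).1 hb
  rw [permWeight, hset, Finset.prod_insert, horb, List.reverse_cons, permWeight]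
  · congr 1
    refine Finset.prod_congr rfl fun a ha => ?_
    rw [(sameCycle_and_orbitList_congr hagree hT (Finset.mem_filter.1 ha).1).2]
  · intro h
    exact hcS (Finset.mem_sdiff.1 (Finset.mem_filter.1 h).1).1

/-- Multiplication by the fixed cycle `(c :: l).formPerm` is a bijection from permutations of the
remaining elements; its inverse turns the letters of `c :: l` into fixed points. -/
theorem sum_permWeight_of_orbitList_eq (m : ℕ) (x y : A) (hl : l.Nodup) (hc : ∀ a ∈ S, c < a)
    (hlS : l.toFinset ⊆ S) :
    ∑ σ ∈ (permsOn (insert c S)).filter (fun σ => orbitList σ c = c :: l),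
        permWeight m x y (insert c S) σ =
      x * runWeight m y 0 (l.reverse ++ [c]) *
        ∑ ρ ∈ permsOn (S \ l.toFinset), permWeight m x y (S \ l.toFinset) ρ := by
  have hcS : c ∉ S := fun h => lt_irrefl _ (hc c h)
  have hl' : (c :: l).Nodup :=
    List.nodup_cons.2 ⟨fun h => hcS (hlS (List.mem_toFinset.2 h)), hl⟩
  rw [Finset.mul_sum]
  symm
  refine Finset.sum_bij' (fun ρ _ => (c :: l).formPerm * ρ) (fun σ _ => (c :: l).formPerm⁻¹ * σ)
    ?_ ?_ ?_ ?_ ?_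
  · intro ρ hρ
    exact Finset.mem_filter.2 (formPerm_mul_mem_permsOn hl' hcS hlS hρ)
  · intro σ hσ
    obtain ⟨h1, h2⟩ := Finset.mem_filter.1 hσ
    rw [mem_permsOn]
    intro a ha
    rw [Equiv.Perm.mul_apply, Equiv.Perm.inv_eq_iff_eq]
    by_cases h3 : a ∈ c :: l
    · rw [← h2] at h3
      rw [← h2, formPerm_orbitList σ c h3]
    · rw [List.formPerm_apply_of_notMem h3]
      refine mem_permsOn.1 h1 a fun h4 => ?_
      rw [List.mem_cons, not_or] at h3
      rw [Finset.mem_sdiff, List.mem_toFinset] at ha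
      exact ha ⟨(Finset.mem_insert.1 h4).resolve_left h3.1, h3.2⟩
  · intro ρ _
    exact inv_mul_cancel_left _ _
  · intro σ _
    exact mul_inv_cancel_left _ _
  · intro ρ hρ
    exact (permWeight_formPerm_mul m x y hl' hc hlS hρ).symm

end Split

theorem sum_permWeight_insert (m : ℕ) (x y : A) {c : Fin n} {S : Finset (Fin n)}
    (hc : ∀ a ∈ S, c < a) :
    ∑ σ ∈ permsOn (insert c S), permWeight m x y (insert c S) σ =
      ∑ D ∈ S.powerset, cycleSum m y c D *
        (x * ∑ ρ ∈ permsOn (S \ D), permWeight m x y (S \ D) ρ) := by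
  have hcS : c ∉ S := fun h => lt_irrefl _ (hc c h)
  have htail : ∀ σ : Equiv.Perm (Fin n), (orbitList σ c).tail.Nodup := fun σ =>
    (nodup_orbitList σ c).sublist (List.tail_sublist _)
  rw [← Finset.sum_fiberwise_of_maps_to (t := S.powerset)
    (g := fun σ : Equiv.Perm (Fin n) => (orbitList σ c).tail.toFinset)]
  · refine Finset.sum_congr rfl fun D hD => ?_
    rw [Finset.mem_powerset] at hD
    rw [← Finset.sum_fiberwise_of_maps_to (t := orderings D)
      (g := fun σ : Equiv.Perm (Fin n) => (orbitList σ c).tail)]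
    · have hrev : cycleSum m y c D =
          ∑ l ∈ orderings D, runWeight m y 0 (l.reverse ++ [c]) := by
        refine Finset.sum_nbij' List.reverse List.reverse ?_ ?_ ?_ ?_ ?_ <;>
          simp [mem_orderings]
      rw [hrev, Finset.sum_mul]
      refine Finset.sum_congr rfl fun l hl => ?_
      obtain ⟨h1, rfl⟩ := mem_orderings.1 hl
      rw [← mul_assoc, mul_comm _ x, ← sum_permWeight_of_orbitList_eq m x y h1 hc hD,
        Finset.filter_filter]
      refine Finset.sum_congr (Finset.filter_congr fun σ _ => ?_) fun _ _ => rfl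
      rw [orbitList_eq_cons σ c]
      simp only [List.tail_cons, List.cons.injEq, true_and]
      exact ⟨fun h => h.2, fun h => ⟨by rw [h], h⟩⟩
    · intro σ hσ
      exact mem_orderings.2 ⟨htail σ, (Finset.mem_filter.1 hσ).2⟩
  · intro σ hσ
    rw [Finset.mem_powerset]
    intro a ha
    rw [List.mem_toFinset] at ha
    have h1 : σ.SameCycle c a := mem_orbitList.1 (List.mem_of_mem_tail ha)
    refine (Finset.mem_insert.1 (mem_of_sameCycle hσ (Finset.mem_insert_self _ _) h1)).resolve_left ?_
    rintro rfl
    have h2 := nodup_orbitList σ a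
    rw [orbitList_eq_cons σ a] at h2
    exact (List.nodup_cons.1 h2).1 ha

/-- Splitting off the cycle of the minimum of `S` is the coefficient form of G' = x C G, which `hd`
verifies for F^(-x); strong induction on `S` then compares the two. -/
theorem sum_permWeight_eq_expCoeff [Algebra ℚ A] (j : ℕ) (x y : A) (S : Finset (Fin n)) :
    ∑ σ ∈ permsOn S, permWeight (j - 1) x y S σ =
      expCoeff (cpow (wordSeries j y) (-x)) S.card := by
  have h0 : PowerSeries.constantCoeff (PowerSeries.C (-x) *
      PowerSeries.logOf (wordSeries j y)) = 0 := by
    rw [map_mul, PowerSeries.constantCoeff_logOf (constantCoeff_wordSeries j y), mul_zero]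
  have hd : PowerSeries.derivative A (cpow (wordSeries j y) (-x)) =
      cycleSeries j y * (PowerSeries.C x * cpow (wordSeries j y) (-x)) := by
    rw [cpow, derivative_expOf h0, Derivation.leibniz, PowerSeries.derivative_C, cycleSeries]
    simp only [smul_eq_mul, mul_zero, add_zero, map_neg]
    ring
  induction S using Finset.strongInduction with
  | H S ih =>
    rcases S.eq_empty_or_nonempty with rfl | hS
    · have h1 : permsOn (∅ : Finset (Fin n)) = {1} := by
        ext σ
        simp [mem_permsOn, Equiv.Perm.ext_iff]
      rw [h1, Finset.sum_singleton, Finset.card_empty, expCoeff,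
        PowerSeries.coeff_zero_eq_constantCoeff_apply, cpow, constantCoeff_expOf h0]
      simp [permWeight]
    · have hc : ∀ a ∈ S.erase (S.min' hS), S.min' hS < a := fun a ha =>
        Finset.min'_lt_of_mem_erase_min' _ _ ha
      have h1 := sum_permWeight_insert (j - 1) x y hc
      rw [Finset.insert_erase (S.min'_mem hS)] at h1
      rw [h1, ← Finset.card_erase_add_one (S.min'_mem hS), ← expCoeff_derivative, hd,
        expCoeff_mul_card]
      refine Finset.sum_congr rfl fun D hD => ?_
      rw [Finset.mem_powerset] at hD
      rw [cycleSum_eq_expCoeff j y _ _ fun a ha => hc a (hD ha),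
        ih _ (Finset.ssubset_of_subset_of_ssubset Finset.sdiff_subset
          (Finset.erase_ssubset (S.min'_mem hS)))]
      simp only [expCoeff, PowerSeries.coeff_C_mul]
      ring

end PermWeight

/-! ### Run weights in terms of ascents and descents -/

section Words

variable {A : Type*} [CommRing A] {α : Type*} [LinearOrder α]

/-- The word `w 0, …, w (p - 1)`, followed by `s` ascents, has `m` consecutive ascents that begin
in the word. -/
def HasRun (m s p : ℕ) (w : ℕ → α) : Prop :=
  ∃ r < p, r + m < p + s ∧ ∀ i, r ≤ i → i < r + m → i + 1 < p → w i < w (i + 1)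

theorem hasRun_of_lt {m s k : ℕ} {w : ℕ → α} (h : w k < w (k + 1)) :
    HasRun m s (k + 2) w ↔ HasRun m (s + 1) (k + 1) w := by
  constructor
  · rintro ⟨r, h1, h2, h3⟩
    rcases Nat.lt_or_ge r (k + 1) with h4 | h4
    · exact ⟨r, h4, by omega, fun i hi hi' hik => h3 i hi hi' (by omega)⟩
    -- A run starting at the dropped letter uses only the appended ascents, so m ≤ s and position
    -- `k` serves as a start.
    · exact ⟨k, by omega, by omega, fun i hi hi' hik => by omega⟩
  · rintro ⟨r, h1, h2, h3⟩
    refine ⟨r, by omega, by omega, fun i hi hi' hik => ?_⟩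
    rcases Nat.lt_or_ge i k with h4 | h4
    · exact h3 i hi hi' (by omega)
    · obtain rfl : i = k := by omega
      exact h

theorem hasRun_of_not_lt {m s k : ℕ} {w : ℕ → α} (h : ¬ w k < w (k + 1)) :
    HasRun m s (k + 2) w ↔ m ≤ s ∨ HasRun m 0 (k + 1) w := by
  constructor
  · rintro ⟨r, h1, h2, h3⟩
    rcases Nat.lt_or_ge r (k + 1) with h4 | h4
    · right
      refine ⟨r, h4, ?_, fun i hi hi' hik => h3 i hi hi' (by omega)⟩
      by_contra h5
      exact h (h3 k (by omega) (by omega) (by omega))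
    · left
      omega
  · rintro (h1 | ⟨r, h1, h2, h3⟩)
    · exact ⟨k + 1, by omega, by omega, fun i hi hi' hik => by omega⟩
    · exact ⟨r, by omega, by omega, fun i hi hi' hik => h3 i hi hi' (by omega)⟩

open Classical in
theorem runWeight_reverse_map_range (m : ℕ) (y : A) (w : ℕ → α) (k s : ℕ)
    (hw : ∀ i < k, w i ≠ w (i + 1)) :
    runWeight m y s ((List.range (k + 1)).map w).reverse =
      if HasRun m s (k + 1) w then 0
      else y ^ (1 + ((Finset.range k).filter fun i => w (i + 1) < w i).card) := by
  induction k generalizing s with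
  | zero =>
    have h : HasRun m s 1 w ↔ m ≤ s := by
      constructor
      · rintro ⟨r, h1, h2, -⟩
        omega
      · intro h
        exact ⟨0, by omega, by omega, fun i _ _ hi => by omega⟩
    by_cases hs : m ≤ s
    · simp [runWeight, h, hs]
    · simp [runWeight, h, hs, not_le.1 hs]
  | succ k ih =>
    have h1 : ((List.range (k + 2)).map w).reverse =
        w (k + 1) :: w k :: ((List.range k).map w).reverse := by
      simp [List.range_succ]
    have h2 : w k :: ((List.range k).map w).reverse =
        ((List.range (k + 1)).map w).reverse := by
      simp [List.range_succ]
    have ih' := fun s => ih s fun i hi => hw i (by omega)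
    rw [h1, runWeight, h2, ih', ih', Finset.range_add_one, Finset.filter_insert]
    by_cases hk : w k < w (k + 1)
    · rw [if_pos hk, if_neg hk.not_gt]
      simp only [hasRun_of_lt hk]
    · have hk' : w (k + 1) < w k := lt_of_le_of_ne (not_lt.1 hk) (hw k (by omega)).symm
      rw [if_neg hk, if_pos hk', Finset.card_insert_of_notMem (by simp)]
      simp only [hasRun_of_not_lt hk]
      by_cases hs : m ≤ s
      · simp [hs]
      · by_cases hr : HasRun m 0 (k + 1) w
        · simp [hr]
        · simp only [hs, hr, not_le.1 hs, if_true, if_false, or_self]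
          ring

end Words

/-! ### Cycle matches as runs, and the conclusion -/

section Matches

variable {n : ℕ}

theorem mem_cycleMinima {σ : Equiv.Perm (Fin n)} {c : Fin n} :
    c ∈ cycleMinima σ ↔ ∀ b, σ.SameCycle c b → c ≤ b := by
  simp [cycleMinima]

theorem exists_mem_cycleMinima (σ : Equiv.Perm (Fin n)) (a : Fin n) :
    ∃ c ∈ cycleMinima σ, σ.SameCycle c a := by
  obtain ⟨c, hc, hmin⟩ := (Finset.univ.filter fun b => σ.SameCycle a b).exists_minimal
    ⟨a, by simp [Equiv.Perm.SameCycle.refl]⟩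
  simp only [Finset.mem_filter, Finset.mem_univ, true_and] at hc hmin
  refine ⟨c, mem_cycleMinima.2 fun b hb => ?_, hc.symm⟩
  rcases le_total c b with h | h
  · exact h
  · exact hmin (hc.trans hb) h

theorem eq_of_mem_cycleMinima {σ : Equiv.Perm (Fin n)} {c d : Fin n} (hc : c ∈ cycleMinima σ)
    (hd : d ∈ cycleMinima σ) (h : σ.SameCycle c d) : c = d :=
  le_antisymm (mem_cycleMinima.1 hc d h) (mem_cycleMinima.1 hd c h.symm)

theorem card_cycleMinima (σ : Equiv.Perm (Fin n)) : (cycleMinima σ).card = cyc σ := by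
  rw [cyc]
  refine Finset.card_bij (fun c _ => Finset.univ.filter fun b => σ.SameCycle c b) ?_ ?_ ?_
  · intro c _
    exact Finset.mem_image_of_mem _ (Finset.mem_univ c)
  · intro c hc d hd h
    have h1 : d ∈ Finset.univ.filter fun b => σ.SameCycle c b := by
      rw [h]
      simp [Equiv.Perm.SameCycle.refl]
    exact eq_of_mem_cycleMinima hc hd (by simpa using h1)
  · intro T hT
    obtain ⟨a, -, rfl⟩ := Finset.mem_image.1 hT
    obtain ⟨c, hc, hca⟩ := exists_mem_cycleMinima σ a
    refine ⟨c, hc, Finset.filter_congr fun b _ => ?_⟩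
    exact ⟨fun h => hca.symm.trans h, fun h => hca.trans h⟩

theorem red_eq_iff_strictMono {j : ℕ} (w : Fin j → ℕ) :
    (∀ i, red w i = (i : ℕ) + 1) ↔ StrictMono w := by
  constructor
  · intro h i k hik
    by_contra h1
    have h2 : red w k ≤ red w i := by
      refine Finset.card_le_card fun l hl => ?_
      simp only [Finset.mem_filter, Finset.mem_univ, true_and] at hl ⊢
      exact hl.trans (not_lt.1 h1)
    rw [h, h] at h2
    exact absurd hik (not_lt.2 (Fin.le_def.2 (by omega)))
  · intro h i
    simp only [red, h.le_iff_le]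
    have : (Finset.univ.filter fun k => k ≤ i) = Finset.Iic i := by
      ext
      simp
    rw [this, Fin.card_Iic]

theorem hasCycleMatch_one_iff {j : ℕ} (hj : 2 ≤ j) (σ : Equiv.Perm (Fin n)) :
    HasCycleMatch (1 : Equiv.Perm (Fin j)) σ ↔
      ∃ c ∈ cycleMinima σ, HasRun (j - 1) 0 (cycleLength σ c) fun i => (σ ^ i) c := by
  have hmono : ∀ c : Fin n, (∀ i : Fin j,
      red (fun k : Fin j => (((σ ^ (k : ℕ)) c : Fin n) : ℕ)) i =
        ((1 : Equiv.Perm (Fin j)) i : ℕ) + 1) ↔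
      ∀ k, k + 1 < j → (σ ^ k) c < (σ ^ (k + 1)) c := by
    intro c
    simp only [Equiv.Perm.one_apply]
    rw [red_eq_iff_strictMono]
    constructor
    · intro h k hk
      exact h (show (⟨k, by omega⟩ : Fin j) < ⟨k + 1, hk⟩ from Nat.lt_succ_self k)
    · intro h a b hab
      have h1 : ∀ d, (a : ℕ) + d + 1 < j → (σ ^ (a : ℕ)) c < (σ ^ ((a : ℕ) + d + 1)) c := by
        intro d
        induction d with
        | zero => exact h a
        | succ d ih => exact fun hd => (ih (by omega)).trans (h _ hd)
      obtain ⟨d, hd⟩ := Nat.exists_eq_add_of_lt (Fin.lt_def.1 hab)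
      have := h1 d (by omega)
      rw [← hd] at this
      exact this
  simp only [HasCycleMatch, hmono]
  constructor
  · rintro ⟨a, hlen, hasc⟩
    obtain ⟨c, hc, hca⟩ := exists_mem_cycleMinima σ a
    have hlen' : cycleLength σ a = cycleLength σ c := by
      rw [cycleLength, cycleLength]
      congr 1
      exact Finset.filter_congr fun b _ => ⟨fun h => hca.trans h, fun h => hca.symm.trans h⟩
    obtain ⟨r, hr, rfl⟩ := exists_pow_eq_of_sameCycle hca
    simp only [← Equiv.Perm.mul_apply, ← pow_add] at hasc
    have hr' : r + (j - 1) < cycleLength σ c := by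
      -- Otherwise the match would include the step from the last letter of the cycle back to `c`,
      -- an ascent ending at the minimum.
      by_contra hcon
      have h1 := hasc (cycleLength σ c - r - 1) (by omega)
      have h2 : cycleLength σ c - r - 1 + 1 + r = cycleLength σ c := by omega
      rw [h2, pow_cycleLength] at h1
      exact absurd (mem_cycleMinima.1 hc _ ((sameCycle_iff_exists_nat σ c _).2 ⟨_, rfl⟩))
        (not_le.2 h1)
    refine ⟨c, hc, r, hr, hr', fun i hi hi' _ => ?_⟩
    have h1 := hasc (i - r) (by omega)
    have h2 : i - r + r = i := by omega
    have h3 : i - r + 1 + r = i + 1 := by omega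
    rwa [h2, h3] at h1
  · rintro ⟨c, hc, r, hr, hr', hasc⟩
    have hca : σ.SameCycle c ((σ ^ r) c) := (sameCycle_iff_exists_nat σ c _).2 ⟨_, rfl⟩
    have hlen' : cycleLength σ ((σ ^ r) c) = cycleLength σ c := by
      rw [cycleLength, cycleLength]
      congr 1
      exact Finset.filter_congr fun b _ => ⟨fun h => hca.trans h, fun h => hca.symm.trans h⟩
    refine ⟨(σ ^ r) c, by omega, fun k hk => ?_⟩
    simp only [← Equiv.Perm.mul_apply, ← pow_add]
    have := hasc (k + r) (by omega) (by omega) (by omega)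
    rwa [show k + 1 + r = k + r + 1 by omega]

variable {A : Type*} [CommRing A]

theorem permWeight_univ {j : ℕ} (hj : 2 ≤ j) (x y : A) (σ : Equiv.Perm (Fin n)) :
    permWeight (j - 1) x y Finset.univ σ =
      if HasCycleMatch (1 : Equiv.Perm (Fin j)) σ then 0 else x ^ cyc σ * y ^ cdes σ := by
  classical
  have hcyc : ∀ c, runWeight (j - 1) y 0 (orbitList σ c).reverse =
      if HasRun (j - 1) 0 (cycleLength σ c) (fun i => (σ ^ i) c) then 0
      else y ^ (1 + des (cycleLength σ c) fun i => (((σ ^ i) c : Fin n) : ℕ)) := by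
    intro c
    obtain ⟨k, hk⟩ := Nat.exists_eq_add_of_le' (cycleLength_pos σ c)
    rw [orbitList, hk, runWeight_reverse_map_range]
    · simp only [des, Nat.add_sub_cancel, Fin.lt_def]
    · intro i hi h
      have := pow_injOn_cycleLength σ c (by omega) (by omega) h
      omega
  rw [permWeight, ← cycleMinima]
  simp only [hcyc]
  split_ifs with h
  · obtain ⟨c, hc, h1⟩ := (hasCycleMatch_one_iff hj σ).1 h
    exact Finset.prod_eq_zero hc (by rw [if_pos h1, mul_zero])
  · rw [Finset.prod_mul_distrib, Finset.prod_const, card_cycleMinima, cdes,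
      ← Finset.prod_pow_eq_pow_sum]
    congr 1
    refine Finset.prod_congr rfl fun c hc => if_neg fun h1 => h ?_
    exact (hasCycleMatch_one_iff hj σ).2 ⟨c, hc, h1⟩

theorem NCM_one_eq_cpow [Algebra ℚ A] (x y : A) (j : ℕ) (hj : 2 ≤ j) :
    NCM (1 : Equiv.Perm (Fin j)) x y = cpow (wordSeries j y) (-x) := by
  ext n
  have h := sum_permWeight_eq_expCoeff j x y (Finset.univ : Finset (Fin n))
  have h1 : permsOn (Finset.univ : Finset (Fin n)) = Finset.univ := by
    ext σ
    simp [mem_permsOn]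
  simp only [h1, permWeight_univ hj, Finset.card_univ, Fintype.card_fin] at h
  rw [NCM, PowerSeries.coeff_mk, noCycleMatch, Finset.sum_filter]
  simp only [ite_not]
  rw [h, expCoeff, algebraMap_inv_factorial_mul]

end Matches

end CyclePattern

theorem mainTheorem6 {A : Type*} [CommRing A] [Algebra ℚ A] (x y : A) (j : ℕ) (hj : 2 ≤ j) :
    CyclePattern.NCM (1 : Equiv.Perm (Fin j)) x y =
        CyclePattern.expOf (PowerSeries.C x *
          PowerSeries.logOf (CyclePattern.recip (CyclePattern.wordSeries j y))) ∧
      CyclePattern.NCM (1 : Equiv.Perm (Fin j)) x y =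
        CyclePattern.cpow (CyclePattern.recip (CyclePattern.wordSeries j y)) x ∧
      CyclePattern.NCM (1 : Equiv.Perm (Fin j)) x y =
        CyclePattern.cpow (CyclePattern.wordSeries j y) (-x) := by
  have h1 := CyclePattern.NCM_one_eq_cpow x y j hj
  have h2 : CyclePattern.cpow (CyclePattern.wordSeries j y) (-x) =
      CyclePattern.cpow (CyclePattern.recip (CyclePattern.wordSeries j y)) x := by
    rw [CyclePattern.cpow, CyclePattern.cpow,
      CyclePattern.logOf_recip (CyclePattern.constantCoeff_wordSeries j y), map_neg, neg_mul,
      mul_neg]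
  exact ⟨h1.trans h2, h1.trans h2, h1⟩
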